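/- **Setting.** Let $V:[0,\infty)\times[0,1]\to\mathbb R$ be continuous with $V(0,x)\ge 0$ for all $x\in[0,1]$. *Parabolic obstacle problem.* A pair $(Z,\eta)$ is a solution of $$\frac{\partial Z}{\partial t}-\frac{\partial^2 Z}{\partial x^2}=\dot\eta,\qquad Z\ge -V,\qquad \int_0^t\!\!\int_0^1 (Z+V)\,d\eta=0 \tag{4.1}$$ if: (1) $Z$ is continuous on $[0,\infty)\times[0,1]$ with $Z(0,x)=0$, $Z(t,0)=Z(t,1)=0$ and $Z(t,x)\ge -V(t,x)$ for all $t\ge0$, $x\in[0,1]$; (2) $\eta$ is a (nonnegative) measure on $[0,\infty)\times(0,1)$ with $\eta([0,T]\times(\varepsilon,1-\varepsilon))<\infty$ for all $\varepsilon,T>0$; (3) for all $t\ge 0$ and all $C^2$ functions $\phi$ with compact support in $(0,1)$, $$\int_0^1 Z(t,x)\phi(x)\,dx-\int_0^t\!\!\int_0^1 Z(s,x)\phi''(x)\,dx\,ds=\int_{[0,t]\times(0,1)}\phi(x)\,\eta(ds,dx);$$ (4) $\int_{[0,t]\times(0,1)}(Z(s,x)+V(s,x))\,\eta(ds,dx)=0$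 for all $t\ge0$. *Discretization.* For $n\ge 1$ let $A^n$ be the $(n-1)\times(n-1)$ matrix with $A^n_{kk}=-2$, $A^n_{ki}=1$ if $|k-i|=1$ and $A^n_{ki}=0$ if $|k-i|>1$, and let $V^n(t)=(V(t,\tfrac1n),\dots,V(t,\tfrac{n-1}n))$. Let $(Z^n,\eta^n)$ be a solution of the Skorohod problem with obstacle $-V^n$: $Z^n,\eta^n:[0,\infty)\to\mathbb R^{n-1}$ are continuous; each $\eta^n_k$ is nondecreasing with $\eta^n_k(0)=0$; and for all $t\ge 0$, $$Z^n(t)=\int_0^t n^2A^nZ^n(s)\,ds+\eta^n(t),\qquad Z^n_k(t)\ge -V^n_k(t)\ (1\le k\le n-1),\qquad \sum_{k=1}^{n-1}\int_0^t (Z^n_k(s)+V^n_k(s))\,d\eta^n_k(s)=0.$$ With $Z^n_0=Z^n_n=0$, let $Z^n(t,x)=Z^n_k(t)+(nx-k)\,(Z^n_{k+1}(t)-Z^n_k(t))$ for $x\in[\tfrac kn,\tfrac{k+1}n)$, $0\le k\le n-1$, and $Z^n(t,1)=0$. **Theorem 4.1.** Let $(Z,\eta)$ be a solution of (4.1) and,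 for each $n\ge1$, let $(Z^n,\eta^n)$ be a solution of the Skorohod problem above. Then for every $T>0$, $$\lim_{n\to\infty}\ \sup_{0\le t\le T,\ 0\le x\le 1}|Z^n(t,x)-Z(t,x)|=0.$$ -/

import Mathlib

open Set Filter Topology MeasureTheory

noncomputable section

namespace ParabolicObstacle

/-- The tridiagonal matrix `A^n` of size `n - 1`: `-2` on the diagonal, `1` for neighbouring
indices, `0` elsewhere. The index `i : Fin (n - 1)` stands for the grid point `(i + 1) / n`. -/
def gridMatrix (n : ℕ) : Matrix (Fin (n - 1)) (Fin (n - 1)) ℝ :=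
  Matrix.of fun k i =>
    if k = i then -2 else if (k : ℕ) + 1 = i ∨ (i : ℕ) + 1 = k then 1 else 0

/-- A continuous nondecreasing function on `[0, ∞)`, extended to the left by its value at `0`,
as a Stieltjes function on the line. Its measure is `df` on `[0, ∞)` and does not charge
`(-∞, 0]`. -/
def stieltjesOfIci (f : ℝ → ℝ) (hc : ContinuousOn f (Ici 0)) (hm : MonotoneOn f (Ici 0)) :
    StieltjesFunction ℝ where
  toFun t := f (max t 0)
  mono' := fun _ _ h => hm (mem_Ici.2 (le_max_right _ _)) (mem_Ici.2 (le_max_right _ _)) (max_le_max_right 0 h)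
  right_continuous' := fun x =>
    ((hc.comp_continuous (continuous_id.max continuous_const)
      (fun _ => mem_Ici.2 (le_max_right _ _))).continuousAt (x := x)).continuousWithinAt

/-- `(Z, η)` solves the Skorohod-type problem in `ℝ^{n-1}` with lower obstacle `-V`:
`dZ = n² A^n Z dt + dη`, `Z ≥ -V`, `∑ i, ∫ (Z_i + V_i) dη_i = 0`, started at `0`.
All functions of time are considered on `[0, ∞)` only. The integrand of the last condition is
nonnegative, so its integral is taken in `[0, ∞]`. -/
structure IsSkorohodSolution (n : ℕ) (V Z η : ℝ → Fin (n - 1) → ℝ) : Prop where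
  continuous_Z : ∀ i, ContinuousOn (fun t => Z t i) (Ici 0)
  obstacle_le : ∀ t, 0 ≤ t → ∀ i, -V t i ≤ Z t i
  continuous_η : ∀ i, ContinuousOn (fun t => η t i) (Ici 0)
  monotone_η : ∀ i, MonotoneOn (fun t => η t i) (Ici 0)
  η_zero : ∀ i, η 0 i = 0
  equation : ∀ t, 0 ≤ t → ∀ i,
    Z t i = (∫ s in (0 : ℝ)..t, (n : ℝ) ^ 2 * (gridMatrix n).mulVec (Z s) i) + η t i
  complementarity : ∀ t, 0 ≤ t →
    ∑ i, ∫⁻ s in Icc 0 t, ENNReal.ofReal (Z s i + V s i)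
      ∂(stieltjesOfIci (fun t => η t i) (continuous_η i) (monotone_η i)).measure = 0

/-- `(Z, η)` solves the parabolic obstacle problem on `[0, ∞) × [0, 1]` with lower obstacle `-V`:
`∂Z/∂t - ∂²Z/∂x² = η` weakly, `Z ≥ -V`, `∫ (Z + V) dη = 0`, with zero initial and boundary
values. `η` is a measure on the plane carried by `[0, ∞) × (0, 1)`. Test functions are `C²` with
compact support in `(0, 1)`. The integrand of the last condition is nonnegative, so its integral
is taken in `[0, ∞]`. -/
structure IsObstacleSolution (V Z : ℝ → ℝ → ℝ) (η : Measure (ℝ × ℝ)) : Prop where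
  continuous_Z : ContinuousOn (fun p : ℝ × ℝ => Z p.1 p.2) (Ici 0 ×ˢ Icc 0 1)
  initial : ∀ x ∈ Icc (0 : ℝ) 1, Z 0 x = 0
  boundary_left : ∀ t, 0 ≤ t → Z t 0 = 0
  boundary_right : ∀ t, 0 ≤ t → Z t 1 = 0
  obstacle_le : ∀ t, 0 ≤ t → ∀ x ∈ Icc (0 : ℝ) 1, -V t x ≤ Z t x
  carried : η (Ici 0 ×ˢ Ioo 0 1)ᶜ = 0
  locally_finite : ∀ ε > 0, ∀ T > 0, η (Icc 0 T ×ˢ Ioo ε (1 - ε)) < ⊤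
  weak_form : ∀ t, 0 ≤ t → ∀ φ : ℝ → ℝ, ContDiff ℝ 2 φ → HasCompactSupport φ →
    tsupport φ ⊆ Ioo 0 1 →
    (∫ x in (0 : ℝ)..1, Z t x * φ x)
        - ∫ s in (0 : ℝ)..t, ∫ x in (0 : ℝ)..1, Z s x * iteratedDeriv 2 φ x
      = ∫ p in Icc 0 t ×ˢ Ioo 0 1, φ p.2 ∂η
  complementarity : ∀ t, 0 ≤ t →
    ∫⁻ p in Icc 0 t ×ˢ Ioo 0 1, ENNReal.ofReal (Z p.1 p.2 + V p.1 p.2) ∂η = 0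

/-- The vector `(V(t, 1/n), …, V(t, (n-1)/n))`. -/
def sample (V : ℝ → ℝ → ℝ) (n : ℕ) : ℝ → Fin (n - 1) → ℝ :=
  fun t i => V t (((i : ℕ) + 1 : ℝ) / n)

/-- The value of a grid function at the node `k / n`, equal to `0` at the nodes `0` and `1`. -/
def nodeValue (n : ℕ) (z : Fin (n - 1) → ℝ) (k : ℕ) : ℝ :=
  if h : 1 ≤ k ∧ k < n then z ⟨k - 1, Nat.sub_lt_sub_right h.1 h.2⟩ else 0

/-- Piecewise linear interpolation on `[0, 1]`: for `k / n ≤ x < (k + 1) / n` it is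
`z_k + (n x - k) (z_{k+1} - z_k)`, with `z_0 = z_n = 0`. At `x = 1` it equals `0`. -/
def interpolate (n : ℕ) (z : Fin (n - 1) → ℝ) (x : ℝ) : ℝ :=
  nodeValue n z ⌊(n : ℝ) * x⌋₊
    + ((n : ℝ) * x - (⌊(n : ℝ) * x⌋₊ : ℝ))
      * (nodeValue n z (⌊(n : ℝ) * x⌋₊ + 1) - nodeValue n z ⌊(n : ℝ) * x⌋₊)

end ParabolicObstacle

end

/-!
The solution `Z` of the obstacle problem is mollified in space only. Testing the weak formulation
with `ρ (· - x)` shows that `z(t, x) = ∫ Z(t, y) ρ(y - x) dy` is, at every fixed `x` away from the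
boundary, of the same form as a component of the discrete problem: it is the time integral of
`∫ Z ρ''(· - x)`, which differs from the second difference quotient of `z` by an error that tends
to zero uniformly as the mesh shrinks, plus a nondecreasing function of time that only grows when
`Z` touches `-V` close to `x`. No regularity in time is needed, because the two solutions are
compared through their increments.

The comparison is a discrete maximum principle (`discrete_maximum_principle`), proved by looking at
the first time at which the difference reaches a strict barrier. Where one solution exceeds the
other by more than the moduli of continuity of `Z` and `V`, the higher one is off its obstacle and
its reflection term is inactive, while the reflection term of the lower one has the favourable sign
(`abs_nodeValue_sub_mollify_le`).

Near `x = 0` and `x = 1` the test functions are not admissible, since `η` may have infinite mass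
there. In that region both solutions are small: `Z` by continuity, and the discrete solutions,
uniformly in the mesh, because they are nonnegative and lie below an affine barrier `ε + K x`
(`exists_nodeValue_le_near_boundary`), which is above the obstacle because `-V ≤ 0` on the boundary.
-/

namespace ParabolicObstacle

/-! ### Continuous functions on the half-strip -/

theorem exists_modulus {f : ℝ → ℝ → ℝ}
    (hf : ContinuousOn (fun p : ℝ × ℝ => f p.1 p.2) (Ici 0 ×ˢ Icc 0 1)) (T : ℝ) {ε : ℝ}
    (hε : 0 < ε) :
    ∃ δ > 0, ∀ s ∈ Icc 0 T, ∀ t ∈ Icc 0 T, ∀ x ∈ Icc (0 : ℝ) 1, ∀ y ∈ Icc (0 : ℝ) 1,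
      |s - t| < δ → |x - y| < δ → |f s x - f t y| < ε := by
  have hc : IsCompact (Icc (0 : ℝ) T ×ˢ Icc (0 : ℝ) 1) := isCompact_Icc.prod isCompact_Icc
  have hu := hc.uniformContinuousOn_of_continuous
    (hf.mono (prod_mono Icc_subset_Ici_self Subset.rfl))
  rw [Metric.uniformContinuousOn_iff] at hu
  obtain ⟨δ, hδ, h⟩ := hu ε hε
  refine ⟨δ, hδ, fun s hs t ht x hx y hy hst hxy => ?_⟩
  have := h (s, x) ⟨hs, hx⟩ (t, y) ⟨ht, hy⟩
  simp only [Prod.dist_eq, Real.dist_eq] at this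
  exact this (max_lt hst hxy)

theorem exists_bound {f : ℝ → ℝ → ℝ}
    (hf : ContinuousOn (fun p : ℝ × ℝ => f p.1 p.2) (Ici 0 ×ˢ Icc 0 1)) (T : ℝ) :
    ∃ M > 0, ∀ t ∈ Icc 0 T, ∀ x ∈ Icc (0 : ℝ) 1, |f t x| ≤ M := by
  have hc : IsCompact (Icc (0 : ℝ) T ×ˢ Icc (0 : ℝ) 1) := isCompact_Icc.prod isCompact_Icc
  obtain ⟨M, hM⟩ := hc.exists_bound_of_continuousOn
    (hf.mono (prod_mono Icc_subset_Ici_self Subset.rfl))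
  exact ⟨max M 1, by positivity, fun t ht x hx =>
    (hM (t, x) ⟨ht, hx⟩).trans (le_max_left _ _)⟩

theorem continuousOn_slice {f : ℝ → ℝ → ℝ}
    (hf : ContinuousOn (fun p : ℝ × ℝ => f p.1 p.2) (Ici 0 ×ˢ Icc 0 1)) {t : ℝ} (ht : 0 ≤ t) :
    ContinuousOn (f t) (Icc 0 1) :=
  hf.comp (f := fun x => (t, x)) (by fun_prop) fun _ hx => ⟨ht, hx⟩

theorem continuousOn_section {f : ℝ → ℝ → ℝ}
    (hf : ContinuousOn (fun p : ℝ × ℝ => f p.1 p.2) (Ici 0 ×ˢ Icc 0 1)) {x : ℝ}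
    (hx : x ∈ Icc (0 : ℝ) 1) : ContinuousOn (fun t => f t x) (Ici 0) :=
  hf.comp (f := fun t => (t, x)) (by fun_prop) fun _ ht => ⟨ht, hx⟩

theorem clamp_mem_Icc (x : ℝ) : max 0 (min x 1) ∈ Icc (0 : ℝ) 1 :=
  ⟨le_max_left _ _, max_le zero_le_one (min_le_right _ _)⟩

theorem clamp_eq_self {x : ℝ} (hx : x ∈ Icc (0 : ℝ) 1) : max 0 (min x 1) = x := by
  rw [min_eq_left hx.2, max_eq_right hx.1]

theorem abs_clamp_sub_clamp_le (x y : ℝ) : |max 0 (min x 1) - max 0 (min y 1)| ≤ |x - y| := by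
  rw [max_comm 0, max_comm 0]
  refine (abs_max_sub_max_le_abs _ _ _).trans ?_
  refine (abs_min_sub_min_le_max _ _ _ _).trans ?_
  simp

theorem intervalIntegrable_mul {f g : ℝ → ℝ} (hf : ContinuousOn f (Icc 0 1)) (hg : Continuous g) :
    IntervalIntegrable (fun y => f y * g y) volume 0 1 :=
  ContinuousOn.intervalIntegrable
    (by rw [uIcc_of_le zero_le_one]; exact hf.mul hg.continuousOn)

theorem continuousOn_integral_mul {f : ℝ → ℝ → ℝ}
    (hf : ContinuousOn (fun p : ℝ × ℝ => f p.1 p.2) (Ici 0 ×ˢ Icc 0 1)) {g : ℝ → ℝ}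
    (hg : Continuous g) : ContinuousOn (fun t => ∫ y in (0 : ℝ)..1, f t y * g y) (Ici 0) := by
  -- Clamping both variables to the half-strip makes the integrand globally continuous.
  have hF : Continuous (Function.uncurry fun t y : ℝ => f (max t 0) (max 0 (min y 1)) * g y) := by
    refine Continuous.mul ?_ (by fun_prop)
    exact hf.comp_continuous (f := fun p : ℝ × ℝ => (max p.1 0, max 0 (min p.2 1)))
      (by fun_prop) fun p => ⟨mem_Ici.2 (le_max_right _ _), clamp_mem_Icc _⟩
  refine (intervalIntegral.continuous_parametric_intervalIntegral_of_continuous'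
    (μ := volume) hF 0 1).continuousOn.congr fun t ht => ?_
  refine intervalIntegral.integral_congr fun y hy => ?_
  rw [uIcc_of_le zero_le_one] at hy
  simp only [max_eq_left (mem_Ici.1 ht), clamp_eq_self hy]

/-! ### Mollification in space -/

/-- The mollification `∫_0^1 f(y) ρ(y - x) dy` of a function on `[0, 1]`, which amounts to
extending `f` by zero. -/
noncomputable def mollify (ρ f : ℝ → ℝ) (x : ℝ) : ℝ :=
  ∫ y in (0 : ℝ)..1, f y * ρ (y - x)

/-- Since `f` vanishes at `0` and `1`, its extension by zero has the same modulus of continuity,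
so the estimate holds up to the boundary. -/
theorem abs_mollify_sub_le {ρ f : ℝ → ℝ} (hf : ContinuousOn f (Icc 0 1)) (hf0 : f 0 = 0)
    (hf1 : f 1 = 0) (hρ : Continuous ρ) (hρc : HasCompactSupport ρ) (hρ0 : ∀ w, 0 ≤ ρ w)
    (hρ1 : ∫ w, ρ w = 1) {r ε : ℝ} (hρr : ∀ w, r ≤ |w| → ρ w = 0)
    (hfr : ∀ x ∈ Icc (0 : ℝ) 1, ∀ y ∈ Icc (0 : ℝ) 1, |x - y| < r → |f x - f y| ≤ ε)
    {x : ℝ} (hx : x ∈ Icc (0 : ℝ) 1) : |mollify ρ f x - f x| ≤ ε := by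
  set G : ℝ → ℝ := fun y => f (max 0 (min y 1)) with hG
  have hGc : Continuous G :=
    hf.comp_continuous (f := fun y : ℝ => max 0 (min y 1)) (by fun_prop) clamp_mem_Icc
  have hρx : Continuous fun y => ρ (y - x) := by fun_prop
  have hρxc : HasCompactSupport fun y => ρ (y - x) := by
    simpa [sub_eq_add_neg, Function.comp_def] using
      hρc.comp_homeomorph (Homeomorph.addRight (-x))
  have hint : Integrable fun y => ρ (y - x) := hρx.integrable_of_hasCompactSupport hρxc
  have hGint : Integrable fun y => G y * ρ (y - x) :=
    (hGc.mul hρx).integrable_of_hasCompactSupport hρxc.mul_left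
  have hone : ∫ y, ρ (y - x) = 1 := by rw [integral_sub_right_eq_self ρ x, hρ1]
  have h1 : mollify ρ f x = ∫ y, G y * ρ (y - x) := by
    rw [mollify, intervalIntegral.integral_of_le zero_le_one,
      ← setIntegral_eq_integral_of_forall_compl_eq_zero (s := Ioc 0 1)
        (f := fun y => G y * ρ (y - x))]
    · refine setIntegral_congr_fun measurableSet_Ioc fun y hy => ?_
      simp only [hG, clamp_eq_self (Ioc_subset_Icc_self hy)]
    · intro y hy
      rcases le_or_gt y 0 with h | h
      · simp [hG, max_eq_left ((min_le_left y 1).trans h), hf0]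
      · have : 1 ≤ y := by
          by_contra! h'
          exact hy ⟨h, h'.le⟩
        simp [hG, this, hf1]
  have h2 : mollify ρ f x - f x = ∫ y, (G y - f x) * ρ (y - x) := by
    simp only [sub_mul]
    rw [integral_sub hGint (hint.const_mul _), integral_const_mul, hone, h1, mul_one]
  rw [h2, ← Real.norm_eq_abs]
  refine (norm_integral_le_of_norm_le (hint.const_mul ε) (ae_of_all _ fun y => ?_)).trans
    (by rw [integral_const_mul, hone, mul_one])
  rw [norm_mul, Real.norm_eq_abs, Real.norm_of_nonneg (hρ0 _)]
  by_cases hy : r ≤ |y - x|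
  · simp [hρr _ hy]
  · refine mul_le_mul_of_nonneg_right (hfr _ (clamp_mem_Icc y) _ hx ?_) (hρ0 _)
    have := abs_clamp_sub_clamp_le y x
    rw [clamp_eq_self hx] at this
    exact this.trans_lt (not_le.1 hy)

/-- The second difference quotient of a compactly supported `C²` function converges uniformly to
its second derivative. -/
theorem exists_second_difference_le {φ : ℝ → ℝ} (hφ : ContDiff ℝ 2 φ) (hφc : HasCompactSupport φ)
    {b : ℝ} (hb : 0 < b) :
    ∃ δ > 0, ∀ h, 0 < h → h < δ → ∀ w,
      |φ (w + h) + φ (w - h) - 2 * φ w - h ^ 2 * iteratedDeriv 2 φ w| ≤ h ^ 2 * b := by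
  have hd1 : Differentiable ℝ φ := hφ.differentiable (by norm_num)
  have hc1 : ContDiff ℝ 1 (deriv φ) := by
    have : ContDiff ℝ (1 + 1) φ := by simpa [one_add_one_eq_two] using hφ
    exact (contDiff_succ_iff_deriv.1 this).2.2
  have hd2 : Differentiable ℝ (deriv φ) := hc1.differentiable (by norm_num)
  have hit : iteratedDeriv 2 φ = deriv (deriv φ) := by
    rw [iteratedDeriv_succ, iteratedDeriv_one]
  have hc2 : Continuous (deriv (deriv φ)) := hc1.continuous_deriv le_rfl
  have hu : UniformContinuous (deriv (deriv φ)) :=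
    hφc.deriv.deriv.uniformContinuous_of_continuous hc2
  obtain ⟨δ, hδ, hmod⟩ := Metric.uniformContinuous_iff.1 hu (b / 2) (by positivity)
  refine ⟨δ, hδ, fun h hh hhδ w => ?_⟩
  rw [hit]
  set c := deriv (deriv φ) w with hc
  -- The mean value theorem is applied to the first derivative and then to the function.
  have hA : ∀ v ∈ Icc 0 h, |deriv φ (w + v) - deriv φ (w - v) - 2 * v * c| ≤ b * h := by
    intro v hv
    have hder : ∀ y, HasDerivAt (fun y => deriv φ y - c * y) (deriv (deriv φ) y - c) y := by
      intro y
      exact (hd2 y).hasDerivAt.fun_sub (by simpa using (hasDerivAt_id y).const_mul c)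
    have := (convex_Icc (w - v) (w + v)).norm_image_sub_le_of_norm_deriv_le
      (f := fun y => deriv φ y - c * y) (C := b / 2) (x := w - v) (y := w + v)
      (fun y _ => (hder y).differentiableAt)
      (fun y hy => by
        rw [(hder y).deriv, ← dist_eq_norm]
        refine (hmod ?_).le
        rw [Real.dist_eq, abs_lt]
        constructor <;> linarith [hy.1, hy.2, hv.2])
      (by constructor <;> linarith [hv.1]) (by constructor <;> linarith [hv.1])
    rw [Real.norm_eq_abs, Real.norm_eq_abs] at this
    have h2 : |w + v - (w - v)| = 2 * v := by
      rw [abs_of_nonneg (by linarith [hv.1])]; ring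
    rw [h2] at this
    calc |deriv φ (w + v) - deriv φ (w - v) - 2 * v * c|
        = |deriv φ (w + v) - c * (w + v) - (deriv φ (w - v) - c * (w - v))| := by
          congr 1; ring
      _ ≤ b / 2 * (2 * v) := this
      _ ≤ b * h := by nlinarith [hv.2]
  have hder : ∀ v, HasDerivAt (fun v => φ (w + v) + φ (w - v) - v ^ 2 * c)
      (deriv φ (w + v) - deriv φ (w - v) - 2 * v * c) v := by
    intro v
    have e1 : HasDerivAt (fun v => φ (w + v)) (deriv φ (w + v)) v :=
      (hd1 (w + v)).hasDerivAt.comp_const_add w v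
    have e2 : HasDerivAt (fun v => φ (w - v)) (-deriv φ (w - v)) v :=
      (hd1 (w - v)).hasDerivAt.comp_const_sub w v
    have e3 : HasDerivAt (fun v : ℝ => v ^ 2 * c) (2 * v * c) v := by
      simpa using (hasDerivAt_pow 2 v).mul_const c
    exact ((e1.add e2).sub e3).congr_deriv (by ring)
  have := (convex_Icc 0 h).norm_image_sub_le_of_norm_deriv_le
    (f := fun v => φ (w + v) + φ (w - v) - v ^ 2 * c) (C := b * h) (x := 0) (y := h)
    (fun v _ => (hder v).differentiableAt)
    (fun v hv => by rw [(hder v).deriv]; exact hA v hv) (by constructor <;> linarith)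
    (by constructor <;> linarith)
  rw [Real.norm_eq_abs, Real.norm_eq_abs, sub_zero h, abs_of_pos hh] at this
  calc |φ (w + h) + φ (w - h) - 2 * φ w - h ^ 2 * c|
      = |φ (w + h) + φ (w - h) - h ^ 2 * c - (φ (w + 0) + φ (w - 0) - 0 ^ 2 * c)| := by
        congr 1; simp only [add_zero, sub_zero]; ring
    _ ≤ b * h * h := this
    _ = h ^ 2 * b := by ring

/-- Mollification turns the second difference into an integral against `ρ''`, up to an error that
does not depend on `x`. -/
theorem abs_mollify_second_difference_le {ρ f : ℝ → ℝ} (hf : ContinuousOn f (Icc 0 1))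
    (hρ : ContDiff ℝ 2 ρ) {M : ℝ} (hfM : ∀ y ∈ Icc (0 : ℝ) 1, |f y| ≤ M) {h b : ℝ}
    (hb : ∀ w, |ρ (w + h) + ρ (w - h) - 2 * ρ w - h ^ 2 * iteratedDeriv 2 ρ w| ≤ h ^ 2 * b)
    (x : ℝ) :
    |mollify ρ f (x + h) + mollify ρ f (x - h) - 2 * mollify ρ f x
      - h ^ 2 * ∫ y in (0 : ℝ)..1, f y * iteratedDeriv 2 ρ (y - x)| ≤ h ^ 2 * (M * b) := by
  have hρc := hρ.continuous
  have hρ2 : Continuous (iteratedDeriv 2 ρ) := hρ.continuous_iteratedDeriv 2 le_rfl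
  have i1 := intervalIntegrable_mul hf (g := fun y => ρ (y - (x + h))) (by fun_prop)
  have i2 := intervalIntegrable_mul hf (g := fun y => ρ (y - (x - h))) (by fun_prop)
  have i3 := intervalIntegrable_mul hf (g := fun y => ρ (y - x)) (by fun_prop)
  have i4 := intervalIntegrable_mul hf (g := fun y => iteratedDeriv 2 ρ (y - x)) (by fun_prop)
  simp only [mollify]
  rw [← intervalIntegral.integral_add i1 i2, ← intervalIntegral.integral_const_mul,
    ← intervalIntegral.integral_sub (i1.add i2) (i3.const_mul 2),
    ← intervalIntegral.integral_const_mul,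
    ← intervalIntegral.integral_sub ((i1.add i2).sub (i3.const_mul 2)) (i4.const_mul _),
    ← Real.norm_eq_abs]
  refine (intervalIntegral.norm_integral_le_of_norm_le_const (C := h ^ 2 * (M * b))
    fun y hy => ?_).trans (by simp)
  rw [uIoc_of_le zero_le_one] at hy
  have hy' := Ioc_subset_Icc_self hy
  have e : f y * ρ (y - (x + h)) + f y * ρ (y - (x - h)) - 2 * (f y * ρ (y - x))
      - h ^ 2 * (f y * iteratedDeriv 2 ρ (y - x))
      = f y * (ρ (y - x + h) + ρ (y - x - h) - 2 * ρ (y - x)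
        - h ^ 2 * iteratedDeriv 2 ρ (y - x)) := by
    rw [show y - (x + h) = y - x - h by ring, show y - (x - h) = y - x + h by ring]; ring
  rw [e, norm_mul, Real.norm_eq_abs, Real.norm_eq_abs]
  calc |f y| * _ ≤ M * (h ^ 2 * b) :=
        mul_le_mul (hfM y hy') (hb _) (abs_nonneg _) ((abs_nonneg _).trans (hfM y hy'))
    _ = h ^ 2 * (M * b) := by ring

/-! ### A discrete maximum principle -/

/-- A family `D` of functions of time on the nodes `0, …, n` that initially is nonpositive and at
every positive maximum over the nodes moves, just before, at most as fast as the heat flow plus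
`b`, stays below `b t`. Only increments are used, so `D` need not be differentiable. -/
theorem discrete_maximum_principle {n : ℕ} {D : ℝ → ℕ → ℝ} {T b c : ℝ} (hb : 0 ≤ b) (hc : 0 ≤ c)
    (hD : ∀ k, ContinuousOn (fun t => D t k) (Ici 0)) (hD0 : ∀ k ≤ n, D 0 k ≤ 0)
    (step : ∀ k ≤ n, ∀ t ∈ Ioc 0 T, 0 < D t k → 0 < k ∧ k < n ∧ ∃ s₁, s₁ < t ∧
      ∀ s ∈ Ico s₁ t, 0 ≤ s →
        D t k - D s k
          ≤ (∫ r in s..t, c * (D r (k + 1) + D r (k - 1) - 2 * D r k)) + b * (t - s)) :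
    ∀ k ≤ n, ∀ t ∈ Icc 0 T, D t k ≤ b * t := by
  have key : ∀ e > 0, ∀ k ≤ n, ∀ t ∈ Icc 0 T, D t k ≤ e * (1 + t) + b * t := by
    intro e he k₀ hk₀ t' ht'
    by_contra! hcon
    -- The first time at which some node reaches the strict barrier `e (1 + t) + b t`.
    set S : Set ℝ := ⋃ k ∈ Finset.range (n + 1),
      {t | t ∈ Icc 0 T ∧ e * (1 + t) + b * t ≤ D t k} with hS
    have hSc : IsClosed S := by
      refine isClosed_biUnion_finset fun k _ => ?_
      have h1 : ContinuousOn (fun t => D t k - (e * (1 + t) + b * t)) (Icc 0 T) :=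
        ((hD k).mono Icc_subset_Ici_self).sub (by fun_prop)
      have := h1.preimage_isClosed_of_isClosed isClosed_Icc isClosed_Ici (t := Ici 0)
      convert this using 1
      ext t
      simp
    have hST : S ⊆ Icc 0 T := by
      intro t ht
      simp only [hS, mem_iUnion] at ht
      obtain ⟨k, _, h, _⟩ := ht
      exact h
    have hmem : ∀ t, t ∈ S ↔ t ∈ Icc 0 T ∧ ∃ k ≤ n, e * (1 + t) + b * t ≤ D t k := by
      intro t
      simp only [hS, mem_iUnion, Finset.mem_range, Nat.lt_succ_iff, mem_ofPred_eq]
      constructor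
      · rintro ⟨k, hk, h, h'⟩; exact ⟨h, k, hk, h'⟩
      · rintro ⟨h, k, hk, h'⟩; exact ⟨k, hk, h, h'⟩
    obtain ⟨t, htS, hleast⟩ := (isCompact_Icc.of_isClosed_subset hSc hST).exists_isLeast
      ⟨t', (hmem t').2 ⟨ht', k₀, hk₀, hcon.le⟩⟩
    obtain ⟨htT, k, hk, hkt⟩ := (hmem t).1 htS
    have ht0 : 0 < t := by
      rcases htT.1.eq_or_lt with h | h
      · exfalso
        subst h
        have := hD0 k hk
        simp at hkt
        linarith
      · exact h
    have hlt : ∀ s ∈ Ico 0 t, ∀ j ≤ n, D s j < e * (1 + s) + b * s := by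
      intro s hs j hj
      by_contra! h
      exact (hs.2.trans_le (hleast ((hmem s).2 ⟨⟨hs.1, hs.2.le.trans htT.2⟩, j, hj, h⟩))).false
    have hle : ∀ j ≤ n, D t j ≤ D t k := by
      intro j hj
      refine le_trans ?_ hkt
      refine ContinuousWithinAt.closure_le (s := Ico 0 t) (f := fun s => D s j)
        (g := fun s => e * (1 + s) + b * s)
        (by rw [closure_Ico ht0.ne]; exact ⟨ht0.le, le_rfl⟩)
        (((hD j) t htT.1).mono Ico_subset_Ici_self)
        (by fun_prop : Continuous fun s : ℝ => e * (1 + s) + b * s).continuousWithinAt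
        (fun s hs => (hlt s hs j hj).le)
    have hpos : 0 < D t k := lt_of_lt_of_le (by positivity) hkt
    obtain ⟨hk0, hkn, s₁, hs₁, hinc⟩ := step k hk t ⟨ht0, htT.2⟩ hpos
    have hcontL : ContinuousOn (fun r => c * (D r (k + 1) + D r (k - 1) - 2 * D r k)) (Ici 0) :=
      (((hD _).add (hD _)).sub ((hD k).const_mul 2)).const_mul c
    -- At the maximum the discrete Laplacian is nonpositive, hence it is small just before.
    have hL : c * (D t (k + 1) + D t (k - 1) - 2 * D t k) < e / 2 := by
      have h1 := hle (k + 1) (by omega)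
      have h2 := hle (k - 1) (by omega)
      have : c * (D t (k + 1) + D t (k - 1) - 2 * D t k) ≤ 0 :=
        mul_nonpos_of_nonneg_of_nonpos hc (by linarith)
      linarith
    have hev := ((hcontL t htT.1).eventually_lt_const hL)
    rw [eventually_iff, Metric.mem_nhdsWithin_iff] at hev
    obtain ⟨d, hd, hball⟩ := hev
    set s := max (max 0 s₁) (t - d / 2) with hs
    have hs0 : 0 ≤ s := (le_max_left _ _).trans (le_max_left _ _)
    have hs1 : s₁ ≤ s := (le_max_right _ _).trans (le_max_left _ _)
    have hs2 : t - d / 2 ≤ s := le_max_right _ _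
    have hst : s < t := max_lt (max_lt ht0 hs₁) (by linarith)
    have h1 := hinc s ⟨hs1, hst⟩ hs0
    have h2 : (∫ r in s..t, c * (D r (k + 1) + D r (k - 1) - 2 * D r k))
        ≤ ∫ _ in s..t, e / 2 := by
      refine intervalIntegral.integral_mono_on hst.le ?_ (by simp) fun r hr => ?_
      · refine (hcontL.mono ?_).intervalIntegrable
        rw [uIcc_of_le hst.le]
        exact fun r hr => hs0.trans hr.1
      · refine le_of_lt (hball ⟨?_, hs0.trans hr.1⟩ : _)
        rw [Metric.mem_ball, Real.dist_eq, abs_lt]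
        constructor <;> linarith [hr.1, hr.2]
    rw [intervalIntegral.integral_const, smul_eq_mul] at h2
    have h3 := hlt s ⟨hs0, hst⟩ k hk
    nlinarith [mul_pos he (sub_pos.2 hst)]
  intro k hk t ht
  have hlim : Tendsto (fun e : ℝ => e * (1 + t) + b * t) (𝓝[>] 0) (𝓝 (b * t)) := by
    have : Continuous fun e : ℝ => e * (1 + t) + b * t := by fun_prop
    simpa using (this.tendsto 0).mono_left nhdsWithin_le_nhds
  exact ge_of_tendsto hlim (eventually_mem_nhdsWithin.mono fun e he => key e he k hk t ht)

/-! ### Increments of the obstacle solution -/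

section Obstacle

variable {V Z : ℝ → ℝ → ℝ} {η : Measure (ℝ × ℝ)}

/-- A compactly supported test function only sees a strip `(ε, 1 - ε)`, where `η` is finite. -/
theorem IsObstacleSolution.integrableOn_test (hZ : IsObstacleSolution V Z η) (t : ℝ) {φ : ℝ → ℝ}
    (hφ : Continuous φ) (hφc : HasCompactSupport φ) (hφs : tsupport φ ⊆ Ioo 0 1) :
    IntegrableOn (fun p : ℝ × ℝ => φ p.2) (Icc 0 t ×ˢ Ioo 0 1) η := by
  obtain ⟨ε, hε, hsub⟩ : ∃ ε > 0, tsupport φ ⊆ Ioo ε (1 - ε) := by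
    rcases (tsupport φ).eq_empty_or_nonempty with h | h
    · exact ⟨1, one_pos, by simp [h]⟩
    · have hcomp : IsCompact (tsupport φ) := hφc
      obtain ⟨a, ha, hmin⟩ := hcomp.exists_isLeast h
      obtain ⟨b, hb, hmax⟩ := hcomp.exists_isGreatest h
      have ha' := hφs ha
      have hb' := hφs hb
      refine ⟨min a (1 - b) / 2, half_pos (lt_min ha'.1 (sub_pos.2 hb'.2)), fun x hx => ?_⟩
      have h1 := hmin hx
      have h2 := hmax hx
      have h3 := min_le_left a (1 - b)
      have h4 := min_le_right a (1 - b)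
      constructor <;> linarith [ha'.1, hb'.2]
  obtain ⟨C, hC⟩ := hφ.bounded_above_of_compact_support hφc
  have hfin : η (Icc 0 t ×ˢ Ioo ε (1 - ε)) < ⊤ :=
    (measure_mono (prod_mono (Icc_subset_Icc_right (le_max_left t 1)) Subset.rfl)).trans_lt
      (hZ.locally_finite ε hε (max t 1) (by positivity))
  refine IntegrableOn.of_forall_sdiff_eq_zero (s := Icc 0 t ×ˢ Ioo ε (1 - ε)) ?_
    (measurableSet_Icc.prod measurableSet_Ioo) fun p hp => ?_
  · exact Measure.integrableOn_of_bounded hfin.ne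
      (hφ.comp continuous_snd).aestronglyMeasurable (ae_of_all _ fun p => hC p.2)
  · by_contra h
    exact hp.2 ⟨hp.1.1, hsub (subset_tsupport φ h)⟩

theorem IsObstacleSolution.increment (hZ : IsObstacleSolution V Z η) {s t : ℝ} (hs : 0 ≤ s)
    (hst : s ≤ t) {φ : ℝ → ℝ} (hφ : ContDiff ℝ 2 φ) (hφc : HasCompactSupport φ)
    (hφs : tsupport φ ⊆ Ioo 0 1) :
    (∫ x in (0 : ℝ)..1, Z t x * φ x) - (∫ x in (0 : ℝ)..1, Z s x * φ x)
      = (∫ r in s..t, ∫ x in (0 : ℝ)..1, Z r x * iteratedDeriv 2 φ x)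
        + ∫ p in Ioc s t ×ˢ Ioo 0 1, φ p.2 ∂η := by
  have ht := hs.trans hst
  have e1 := hZ.weak_form t ht φ hφ hφc hφs
  have e2 := hZ.weak_form s hs φ hφ hφc hφs
  have hint := hZ.integrableOn_test t hφ.continuous hφc hφs
  have hpair := continuousOn_integral_mul hZ.continuous_Z (hφ.continuous_iteratedDeriv 2 le_rfl)
  have hii : ∀ u, 0 ≤ u → IntervalIntegrable
      (fun r => ∫ x in (0 : ℝ)..1, Z r x * iteratedDeriv 2 φ x) volume 0 u := fun u hu =>
    (hpair.mono (by rw [uIcc_of_le hu]; exact Icc_subset_Ici_self)).intervalIntegrable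
  have e3 := intervalIntegral.integral_interval_sub_left (hii t ht) (hii s hs)
  have hset : (Icc 0 t ×ˢ Ioo (0 : ℝ) 1) = Icc 0 s ×ˢ Ioo 0 1 ∪ Ioc s t ×ˢ Ioo 0 1 := by
    rw [← union_prod, Icc_union_Ioc_eq_Icc hs hst]
  have hdisj : Disjoint (Icc 0 s ×ˢ Ioo (0 : ℝ) 1) (Ioc s t ×ˢ Ioo 0 1) := by
    rw [Set.disjoint_left]
    exact fun p hp hq => absurd hp.1.2 (not_le.2 hq.1.1)
  have e4 : ∫ p in Icc 0 t ×ˢ Ioo 0 1, φ p.2 ∂η = (∫ p in Icc 0 s ×ˢ Ioo 0 1, φ p.2 ∂η)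
      + ∫ p in Ioc s t ×ˢ Ioo 0 1, φ p.2 ∂η := by
    rw [hset] at hint ⊢
    exact setIntegral_union hdisj (measurableSet_Ioc.prod measurableSet_Ioo)
      (hint.mono_set subset_union_left) (hint.mono_set subset_union_right)
  linarith

theorem IsObstacleSolution.le_increment (hZ : IsObstacleSolution V Z η) {s t : ℝ} (hs : 0 ≤ s)
    (hst : s ≤ t) {φ : ℝ → ℝ} (hφ : ContDiff ℝ 2 φ) (hφc : HasCompactSupport φ)
    (hφs : tsupport φ ⊆ Ioo 0 1) (hφ0 : ∀ x, 0 ≤ φ x) :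
    (∫ r in s..t, ∫ x in (0 : ℝ)..1, Z r x * iteratedDeriv 2 φ x)
      ≤ (∫ x in (0 : ℝ)..1, Z t x * φ x) - (∫ x in (0 : ℝ)..1, Z s x * φ x) := by
  rw [hZ.increment hs hst hφ hφc hφs]
  exact le_add_of_nonneg_right (integral_nonneg fun p => hφ0 p.2)

/-- While `Z` stays off the obstacle on the support of `φ`, the measure does not act. -/
theorem IsObstacleSolution.increment_eq (hZ : IsObstacleSolution V Z η)
    (hV : ContinuousOn (fun p : ℝ × ℝ => V p.1 p.2) (Ici 0 ×ˢ Icc 0 1)) {s t : ℝ} (hs : 0 ≤ s)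
    (hst : s ≤ t) {φ : ℝ → ℝ} (hφ : ContDiff ℝ 2 φ) (hφc : HasCompactSupport φ)
    (hφs : tsupport φ ⊆ Ioo 0 1)
    (hoff : ∀ r ∈ Icc s t, ∀ x ∈ Ioo (0 : ℝ) 1, φ x ≠ 0 → 0 < Z r x + V r x) :
    (∫ x in (0 : ℝ)..1, Z t x * φ x) - (∫ x in (0 : ℝ)..1, Z s x * φ x)
      = ∫ r in s..t, ∫ x in (0 : ℝ)..1, Z r x * iteratedDeriv 2 φ x := by
  rw [hZ.increment hs hst hφ hφc hφs, add_eq_left]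
  have hms : MeasurableSet (Icc 0 t ×ˢ Ioo (0 : ℝ) 1) := measurableSet_Icc.prod measurableSet_Ioo
  have hmeas : AEMeasurable (fun p : ℝ × ℝ => ENNReal.ofReal (Z p.1 p.2 + V p.1 p.2))
      (η.restrict (Icc 0 t ×ˢ Ioo 0 1)) :=
    (((hZ.continuous_Z.add hV).mono
      (prod_mono Icc_subset_Ici_self Ioo_subset_Icc_self)).aemeasurable hms).ennreal_ofReal
  have h0 := (lintegral_eq_zero_iff' hmeas).1 (hZ.complementarity t (hs.trans hst))
  have h1 := (ae_restrict_iff' hms).1 h0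
  refine setIntegral_eq_zero_of_ae_eq_zero ?_
  filter_upwards [h1] with p hp hpm
  by_contra hne
  have hpos := hoff p.1 (Ioc_subset_Icc_self hpm.1) p.2 hpm.2 hne
  have := hp ⟨⟨hs.trans hpm.1.1.le, hpm.1.2⟩, hpm.2⟩
  simp only [Pi.zero_apply, ENNReal.ofReal_eq_zero] at this
  linarith

end Obstacle

/-! ### Increments of the discrete solutions -/

theorem nodeValue_succ {n : ℕ} (z : Fin (n - 1) → ℝ) (i : Fin (n - 1)) :
    nodeValue n z (i + 1) = z i := by
  have := i.2
  rw [nodeValue, dif_pos ⟨by omega, by omega⟩]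
  congr 1

theorem nodeValue_of_le {n k : ℕ} (z : Fin (n - 1) → ℝ) (hk : n ≤ k) : nodeValue n z k = 0 :=
  dif_neg fun h => absurd h.2 (not_lt.2 hk)

theorem nodeValue_zero {n : ℕ} (z : Fin (n - 1) → ℝ) : nodeValue n z 0 = 0 :=
  dif_neg fun h => absurd h.1 (by norm_num)

theorem nodeValue_eq_sum {n k : ℕ} (z : Fin (n - 1) → ℝ) :
    nodeValue n z k = ∑ i : Fin (n - 1), if (i : ℕ) + 1 = k then z i else 0 := by
  by_cases h : 1 ≤ k ∧ k < n
  · obtain ⟨i, rfl⟩ : ∃ i : Fin (n - 1), (i : ℕ) + 1 = k := ⟨⟨k - 1, by omega⟩, by simp; omega⟩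
    rw [nodeValue_succ, Finset.sum_eq_single i]
    · simp
    · intro j _ hj
      rw [if_neg]
      exact fun h => hj (Fin.ext (by omega))
    · simp
  · rw [nodeValue, dif_neg h, Finset.sum_eq_zero]
    intro i _
    rw [if_neg]
    have := i.2
    omega

/-- The matrix `A^n` is the second difference with zero boundary values. -/
theorem gridMatrix_mulVec {n : ℕ} (z : Fin (n - 1) → ℝ) (i : Fin (n - 1)) :
    (gridMatrix n).mulVec z i
      = nodeValue n z (i + 1 + 1) + nodeValue n z (i + 1 - 1) - 2 * nodeValue n z (i + 1) := by
  rw [nodeValue_eq_sum, nodeValue_eq_sum, nodeValue_eq_sum, Finset.mul_sum,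
    ← Finset.sum_add_distrib, ← Finset.sum_sub_distrib, Matrix.mulVec, dotProduct]
  refine Finset.sum_congr rfl fun j _ => ?_
  simp only [gridMatrix, Matrix.of_apply, Fin.ext_iff]
  split_ifs <;> first | omega | ring

theorem continuousOn_nodeValue {n : ℕ} {Z : ℝ → Fin (n - 1) → ℝ}
    (hZ : ∀ i, ContinuousOn (fun t => Z t i) (Ici 0)) (k : ℕ) :
    ContinuousOn (fun t => nodeValue n (Z t) k) (Ici 0) := by
  by_cases h : 1 ≤ k ∧ k < n
  · simp only [nodeValue, dif_pos h]
    exact hZ _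
  · simp only [nodeValue, dif_neg h]
    exact continuousOn_const

section Skorohod

variable {n : ℕ} {V Z η : ℝ → Fin (n - 1) → ℝ}

theorem IsSkorohodSolution.continuousOn_nodeValue (h : IsSkorohodSolution n V Z η) (k : ℕ) :
    ContinuousOn (fun t => nodeValue n (Z t) k) (Ici 0) :=
  ParabolicObstacle.continuousOn_nodeValue h.continuous_Z k

theorem IsSkorohodSolution.nodeValue_initial (h : IsSkorohodSolution n V Z η) (k : ℕ) :
    nodeValue n (Z 0) k = 0 := by
  by_cases hk : 1 ≤ k ∧ k < n
  · simp [nodeValue, dif_pos hk, h.equation 0 le_rfl, h.η_zero]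
  · rw [nodeValue, dif_neg hk]

theorem IsSkorohodSolution.increment (h : IsSkorohodSolution n V Z η) {s t : ℝ} (hs : 0 ≤ s)
    (hst : s ≤ t) (i : Fin (n - 1)) :
    nodeValue n (Z t) (i + 1) - nodeValue n (Z s) (i + 1)
      = (∫ r in s..t, (n : ℝ) ^ 2 * (nodeValue n (Z r) (i + 1 + 1) + nodeValue n (Z r) (i + 1 - 1)
          - 2 * nodeValue n (Z r) (i + 1))) + (η t i - η s i) := by
  have ht := hs.trans hst
  have e1 := h.equation t ht i
  have e2 := h.equation s hs i
  simp only [gridMatrix_mulVec] at e1 e2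
  have hc : ContinuousOn (fun r => (n : ℝ) ^ 2 * (nodeValue n (Z r) (i + 1 + 1)
      + nodeValue n (Z r) (i + 1 - 1) - 2 * nodeValue n (Z r) (i + 1))) (Ici 0) :=
    (((h.continuousOn_nodeValue _).add (h.continuousOn_nodeValue _)).sub
      ((h.continuousOn_nodeValue _).const_mul 2)).const_mul _
  have hii : ∀ u, 0 ≤ u → IntervalIntegrable (fun r => (n : ℝ) ^ 2 *
      (nodeValue n (Z r) (i + 1 + 1) + nodeValue n (Z r) (i + 1 - 1)
        - 2 * nodeValue n (Z r) (i + 1))) volume 0 u := fun u hu =>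
    (hc.mono (by rw [uIcc_of_le hu]; exact Icc_subset_Ici_self)).intervalIntegrable
  have e3 := intervalIntegral.integral_interval_sub_left (hii t ht) (hii s hs)
  rw [nodeValue_succ, nodeValue_succ]
  linarith

/-- While `Z_i` stays off the obstacle, `η_i` is constant. -/
theorem IsSkorohodSolution.η_eq (h : IsSkorohodSolution n V Z η)
    (hV : ∀ i, ContinuousOn (fun t => V t i) (Ici 0)) {s t : ℝ} (hs : 0 ≤ s) (hst : s ≤ t)
    (i : Fin (n - 1)) (hoff : ∀ r ∈ Icc s t, 0 < Z r i + V r i) : η t i = η s i := by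
  have ht := hs.trans hst
  have h0 := (Finset.sum_eq_zero_iff.1 (h.complementarity t ht)) i (Finset.mem_univ i)
  set μ := (stieltjesOfIci (fun t => η t i) (h.continuous_η i) (h.monotone_η i)).measure with hμ
  have hmeas : AEMeasurable (fun s => ENNReal.ofReal (Z s i + V s i)) (μ.restrict (Icc 0 t)) :=
    ((((h.continuous_Z i).add (hV i)).mono Icc_subset_Ici_self).aemeasurable
      measurableSet_Icc).ennreal_ofReal
  have h1 := (ae_restrict_iff' measurableSet_Icc).1 ((lintegral_eq_zero_iff' hmeas).1 h0)
  have h2 : μ (Ioc s t) = 0 := by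
    refine measure_mono_null (fun r hr => ?_) (ae_iff.1 h1)
    simp only [mem_ofPred_eq, Pi.zero_apply, ENNReal.ofReal_eq_zero, Classical.not_imp, not_le]
    exact ⟨⟨hs.trans hr.1.le, hr.2⟩, hoff r (Ioc_subset_Icc_self hr)⟩
  rw [hμ, StieltjesFunction.measure_Ioc, ENNReal.ofReal_eq_zero] at h2
  have h3 : η t i - η s i ≤ 0 := by
    simpa [stieltjesOfIci, max_eq_left hs, max_eq_left ht] using h2
  have h4 := h.monotone_η i (mem_Ici.2 hs) (mem_Ici.2 ht) hst
  simp only at h4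
  linarith

theorem IsSkorohodSolution.le_increment (h : IsSkorohodSolution n V Z η) {s t : ℝ} (hs : 0 ≤ s)
    (hst : s ≤ t) {k : ℕ} (hk0 : 0 < k) (hkn : k < n) :
    (∫ r in s..t, (n : ℝ) ^ 2 * (nodeValue n (Z r) (k + 1) + nodeValue n (Z r) (k - 1)
          - 2 * nodeValue n (Z r) k)) ≤ nodeValue n (Z t) k - nodeValue n (Z s) k := by
  obtain ⟨i, rfl⟩ : ∃ i : Fin (n - 1), (i : ℕ) + 1 = k := ⟨⟨k - 1, by omega⟩, by simp; omega⟩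
  rw [h.increment hs hst]
  exact le_add_of_nonneg_right (sub_nonneg.2
    (h.monotone_η i (mem_Ici.2 hs) (mem_Ici.2 (hs.trans hst)) hst))

end Skorohod

section Sampled

variable {V : ℝ → ℝ → ℝ} {n : ℕ} {Z η : ℝ → Fin (n - 1) → ℝ}

theorem node_mem_Icc {n k : ℕ} (hn : 1 ≤ n) (hk : k ≤ n) : (k : ℝ) / n ∈ Icc (0 : ℝ) 1 := by
  have hn' : (0 : ℝ) < n := by exact_mod_cast hn
  exact ⟨by positivity, (div_le_one hn').2 (by exact_mod_cast hk)⟩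

theorem continuousOn_sample (hV : ContinuousOn (fun p : ℝ × ℝ => V p.1 p.2) (Ici 0 ×ˢ Icc 0 1))
    (n : ℕ) (i : Fin (n - 1)) : ContinuousOn (fun t => sample V n t i) (Ici 0) := by
  have hi := i.2
  have := node_mem_Icc (n := n) (k := i + 1) (by omega) (by omega)
  push_cast at this
  exact continuousOn_section hV this

/-- If the discrete solution is strictly above the obstacle at a node and a time, then just before
that time it follows the discrete heat equation there. -/
theorem IsSkorohodSolution.exists_increment_eq
    (hV : ContinuousOn (fun p : ℝ × ℝ => V p.1 p.2) (Ici 0 ×ˢ Icc 0 1))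
    (h : IsSkorohodSolution n (sample V n) Z η) {t : ℝ} (ht : 0 ≤ t) {k : ℕ} (hk0 : 0 < k)
    (hkn : k < n) (hoff : 0 < nodeValue n (Z t) k + V t (k / n)) :
    ∃ s₁, s₁ < t ∧ ∀ s ∈ Ico s₁ t, 0 ≤ s →
      nodeValue n (Z t) k - nodeValue n (Z s) k
        = ∫ r in s..t, (n : ℝ) ^ 2 * (nodeValue n (Z r) (k + 1) + nodeValue n (Z r) (k - 1)
            - 2 * nodeValue n (Z r) k) := by
  obtain ⟨i, rfl⟩ : ∃ i : Fin (n - 1), (i : ℕ) + 1 = k := ⟨⟨k - 1, by omega⟩, by simp; omega⟩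
  have hoff' : 0 < Z t i + sample V n t i := by
    simpa [nodeValue_succ, sample] using hoff
  have hev := ((h.continuous_Z i).add (continuousOn_sample hV n i)) t ht |>.eventually_const_lt
    hoff'
  rw [eventually_iff, Metric.mem_nhdsWithin_iff] at hev
  obtain ⟨d, hd, hball⟩ := hev
  refine ⟨t - d / 2, by linarith, fun s hs hs0 => ?_⟩
  rw [h.increment hs0 hs.2.le, h.η_eq (continuousOn_sample hV n) hs0 hs.2.le i, sub_self, add_zero]
  intro r hr
  refine hball ⟨?_, hs0.trans hr.1⟩
  rw [Metric.mem_ball, Real.dist_eq, abs_lt]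
  constructor <;> linarith [hr.1, hr.2, hs.1]

theorem IsSkorohodSolution.obstacle_le_nodeValue (h : IsSkorohodSolution n (sample V n) Z η)
    {t : ℝ} (ht : 0 ≤ t) {k : ℕ} (hk0 : 0 < k) (hkn : k < n) :
    -V t (k / n) ≤ nodeValue n (Z t) k := by
  obtain ⟨i, rfl⟩ : ∃ i : Fin (n - 1), (i : ℕ) + 1 = k := ⟨⟨k - 1, by omega⟩, by simp; omega⟩
  simpa [nodeValue_succ, sample] using h.obstacle_le t ht i

theorem IsSkorohodSolution.nodeValue_nonneg {W : ℝ → Fin (n - 1) → ℝ}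
    (h : IsSkorohodSolution n W Z η) {t : ℝ}
    (ht : 0 ≤ t) {k : ℕ} (hk : k ≤ n) : 0 ≤ nodeValue n (Z t) k := by
  have := discrete_maximum_principle (n := n) (D := fun t k => -nodeValue n (Z t) k) (T := t)
    (b := 0) (c := (n : ℝ) ^ 2) le_rfl (by positivity) (fun k => (h.continuousOn_nodeValue k).neg)
    (fun k _ => by simp [h.nodeValue_initial]) (fun j hj u hu hpos => ?_) k hk t ⟨ht, le_rfl⟩
  · simpa using this
  · beta_reduce at hpos
    have hj0 : 0 < j := Nat.pos_of_ne_zero fun h0 => by simp [h0, nodeValue_zero] at hpos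
    have hjn : j < n := lt_of_not_ge fun h0 => by simp [nodeValue_of_le _ h0] at hpos
    refine ⟨hj0, hjn, u - 1, by linarith, fun s hs hs0 => ?_⟩
    have := h.le_increment hs0 hs.2.le hj0 hjn
    have e : (∫ r in s..u, (n : ℝ) ^ 2 * (-nodeValue n (Z r) (j + 1) + -nodeValue n (Z r) (j - 1)
        - 2 * -nodeValue n (Z r) j)) = -∫ r in s..u, (n : ℝ) ^ 2 * (nodeValue n (Z r) (j + 1)
          + nodeValue n (Z r) (j - 1) - 2 * nodeValue n (Z r) j) := by
      rw [← intervalIntegral.integral_neg]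
      congr 1
      ext r
      ring
    rw [e]
    linarith

/-- An affine function above the obstacle that is nonnegative on `[0, 1]` is a supersolution. -/
theorem IsSkorohodSolution.nodeValue_le_affine
    (hV : ContinuousOn (fun p : ℝ × ℝ => V p.1 p.2) (Ici 0 ×ˢ Icc 0 1))
    (h : IsSkorohodSolution n (sample V n) Z η) (hn : 1 ≤ n) {T a b : ℝ}
    (hpos : ∀ x ∈ Icc (0 : ℝ) 1, 0 ≤ a + b * x)
    (hobs : ∀ t ∈ Icc 0 T, ∀ x ∈ Icc (0 : ℝ) 1, -V t x ≤ a + b * x) {t : ℝ} (ht : t ∈ Icc 0 T)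
    {k : ℕ} (hk : k ≤ n) : nodeValue n (Z t) k ≤ a + b * (k / n) := by
  have := discrete_maximum_principle (n := n)
    (D := fun t k => nodeValue n (Z t) k - (a + b * (k / n))) (T := T)
    (b := 0) (c := (n : ℝ) ^ 2) le_rfl (by positivity)
    (fun k => (h.continuousOn_nodeValue k).sub continuousOn_const)
    (fun k hk => by
      rw [h.nodeValue_initial]
      linarith [hpos _ (node_mem_Icc hn hk)])
    (fun j hj u hu hlt => ?_) k hk t ht
  · simpa using this
  · beta_reduce at hlt
    have hj1 := hpos _ (node_mem_Icc hn hj)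
    have hj0 : 0 < j := Nat.pos_of_ne_zero fun h0 => by
      subst h0
      rw [nodeValue_zero] at hlt
      linarith
    have hjn : j < n := lt_of_not_ge fun h0 => by
      rw [nodeValue_of_le _ h0] at hlt
      linarith
    obtain ⟨s₁, hs₁, hinc⟩ := h.exists_increment_eq hV hu.1.le hj0 hjn (by
      linarith [hobs u ⟨hu.1.le, hu.2⟩ _ (node_mem_Icc hn hj)])
    refine ⟨hj0, hjn, s₁, hs₁, fun s hs hs0 => le_of_eq ?_⟩
    rw [sub_sub_sub_cancel_right, hinc s hs hs0, zero_mul, add_zero]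
    congr 1
    ext r
    push_cast [Nat.cast_sub (Nat.one_le_iff_ne_zero.2 hj0.ne')]
    ring

end Sampled

/-! ### Comparison of the discrete solution with the mollified solution -/

theorem tsupport_comp_sub_subset {ρ : ℝ → ℝ} {r : ℝ} (hρs : tsupport ρ ⊆ Metric.closedBall 0 r)
    {x : ℝ} (hx : x ∈ Ioo r (1 - r)) : tsupport (fun y => ρ (y - x)) ⊆ Ioo 0 1 := by
  have h1 : tsupport (fun y => ρ (y - x)) ⊆ Metric.closedBall x r := by
    refine closure_minimal (fun y hy => ?_) Metric.isClosed_closedBall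
    have := hρs (subset_tsupport ρ hy)
    simpa [Real.dist_eq] using this
  refine h1.trans fun y hy => ?_
  rw [Metric.mem_closedBall, Real.dist_eq, abs_le] at hy
  constructor <;> linarith [hy.1, hy.2, hx.1, hx.2]

/-- The barrier `ε + K x` and its mirror image bound the discrete solutions near the boundary,
uniformly in the mesh. Its slope is finite because the obstacle is nonpositive on the boundary. -/
theorem exists_nodeValue_le_near_boundary {V : ℝ → ℝ → ℝ}
    (hV : ContinuousOn (fun p : ℝ × ℝ => V p.1 p.2) (Ici 0 ×ˢ Icc 0 1)) {T : ℝ}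
    (hleft : ∀ t ∈ Icc 0 T, 0 ≤ V t 0) (hright : ∀ t ∈ Icc 0 T, 0 ≤ V t 1) {ε : ℝ} (hε : 0 < ε) :
    ∃ δ > 0, ∀ (n : ℕ) (Z η : ℝ → Fin (n - 1) → ℝ), 1 ≤ n →
      IsSkorohodSolution n (sample V n) Z η → ∀ t ∈ Icc 0 T, ∀ k ≤ n,
        (k : ℝ) / n ∉ Ioo δ (1 - δ) → nodeValue n (Z t) k ≤ 2 * ε := by
  obtain ⟨d, hd, hmod⟩ := exists_modulus hV T hε
  obtain ⟨M, hM, hbd⟩ := exists_bound hV T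
  have hK : 0 < M / d := by positivity
  refine ⟨ε / (M / d), by positivity, fun n Z η hn h t ht k hk hknot => ?_⟩
  have h0 : (0 : ℝ) ∈ Icc (0 : ℝ) 1 := by simp
  have h1 : (1 : ℝ) ∈ Icc (0 : ℝ) 1 := by simp
  have hkx := node_mem_Icc hn hk
  have hslope : M / d * (ε / (M / d)) = ε := mul_div_cancel₀ _ hK.ne'
  have hfar : ∀ u, d ≤ u → M ≤ M / d * u := fun u hu => by
    calc M = M / d * d := by field_simp
      _ ≤ M / d * u := mul_le_mul_of_nonneg_left hu hK.le
  rw [mem_Ioo, not_and_or, not_lt, not_lt] at hknot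
  rcases hknot with hl | hr
  · have := h.nodeValue_le_affine hV hn (a := ε) (b := M / d)
      (fun x hx => by have := mul_nonneg hK.le hx.1; linarith)
      (fun s hs x hx => by
        rcases lt_or_ge x d with hxd | hxd
        · have := hmod s hs s hs 0 h0 x hx (by simpa using hd)
            (by rwa [zero_sub, abs_neg, abs_of_nonneg hx.1])
          have h2 := (abs_lt.1 this).2
          have h3 := hleft s hs
          have h4 := mul_nonneg hK.le hx.1
          linarith
        · have h2 := (abs_le.1 (hbd s hs x hx)).1
          linarith [hfar x hxd]) ht hk
    have h2 := mul_le_mul_of_nonneg_left hl hK.le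
    linarith
  · have := h.nodeValue_le_affine hV hn (a := ε + M / d) (b := -(M / d))
      (fun x hx => by have := mul_nonneg hK.le (sub_nonneg.2 hx.2); linarith)
      (fun s hs x hx => by
        rcases lt_or_ge (1 - x) d with hxd | hxd
        · have := hmod s hs s hs 1 h1 x hx (by simpa using hd)
            (by rwa [abs_of_nonneg (sub_nonneg.2 hx.2)])
          have h2 := (abs_lt.1 this).2
          have h3 := hright s hs
          have h4 := mul_nonneg hK.le (sub_nonneg.2 hx.2)
          linarith
        · have h2 := (abs_le.1 (hbd s hs x hx)).1
          linarith [hfar (1 - x) hxd]) ht hk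
    have h2 := mul_le_mul_of_nonneg_left (by linarith : 1 - (k : ℝ) / n ≤ ε / (M / d)) hK.le
    linarith

/-- Where the two differ by more than `4 ε`, the higher one is off the obstacle, so its reflection
term is inactive, while the reflection term of the lower one reduces the difference. The maximum
principle thus applies to both differences. -/
theorem abs_nodeValue_sub_mollify_le {V Z : ℝ → ℝ → ℝ} {η : Measure (ℝ × ℝ)}
    (hV : ContinuousOn (fun p : ℝ × ℝ => V p.1 p.2) (Ici 0 ×ˢ Icc 0 1))
    (hZ : IsObstacleSolution V Z η) {n : ℕ} (hn : 1 ≤ n) {Y ξ : ℝ → Fin (n - 1) → ℝ}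
    (hY : IsSkorohodSolution n (sample V n) Y ξ) {T ε d r b : ℝ} (hε : 0 < ε) (hd : 0 < d)
    (hb : 0 ≤ b) (hrd : r < d) {ρ : ℝ → ℝ} (hρ : ContDiff ℝ 2 ρ) (hρc : HasCompactSupport ρ)
    (hρ0 : ∀ w, 0 ≤ ρ w) (hρs : tsupport ρ ⊆ Metric.closedBall 0 r)
    (hmodZ : ∀ s ∈ Icc 0 T, ∀ t ∈ Icc 0 T, ∀ x ∈ Icc (0 : ℝ) 1, ∀ y ∈ Icc (0 : ℝ) 1,
      |s - t| < d → |x - y| < d → |Z s x - Z t y| < ε)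
    (hmodV : ∀ s ∈ Icc 0 T, ∀ t ∈ Icc 0 T, ∀ x ∈ Icc (0 : ℝ) 1, ∀ y ∈ Icc (0 : ℝ) 1,
      |s - t| < d → |x - y| < d → |V s x - V t y| < ε)
    (happrox : ∀ t ∈ Icc 0 T, ∀ x ∈ Icc (0 : ℝ) 1, |mollify ρ (Z t) x - Z t x| ≤ ε)
    (herr : ∀ t ∈ Icc 0 T, ∀ x, |(n : ℝ) ^ 2 * (mollify ρ (Z t) (x + 1 / n)
      + mollify ρ (Z t) (x - 1 / n) - 2 * mollify ρ (Z t) x)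
        - ∫ y in (0 : ℝ)..1, Z t y * iteratedDeriv 2 ρ (y - x)| ≤ b)
    (hbdY : ∀ t ∈ Icc 0 T, ∀ k ≤ n, (k : ℝ) / n ∉ Ioo r (1 - r) → nodeValue n (Y t) k ≤ 2 * ε)
    (hbdZ : ∀ t ∈ Icc 0 T, ∀ x ∈ Icc (0 : ℝ) 1, x ∉ Ioo r (1 - r) → |Z t x| ≤ ε)
    {t : ℝ} (ht : t ∈ Icc 0 T) {k : ℕ} (hk : k ≤ n) :
    |nodeValue n (Y t) k - mollify ρ (Z t) (k / n)| ≤ 4 * ε + b * t := by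
  set N : ℝ → ℕ → ℝ := fun t k => nodeValue n (Y t) k with hN
  set z : ℝ → ℕ → ℝ := fun t k => mollify ρ (Z t) (k / n) with hz
  have hNc : ∀ k, ContinuousOn (fun t => N t k) (Ici 0) := hY.continuousOn_nodeValue
  have hρcont := hρ.continuous
  have hzc : ∀ k, ContinuousOn (fun t => z t k) (Ici 0) := fun k =>
    continuousOn_integral_mul hZ.continuous_Z (g := fun y => ρ (y - k / n)) (by fun_prop)
  have hρ2 : Continuous (iteratedDeriv 2 ρ) := hρ.continuous_iteratedDeriv 2 le_rfl
  have hn0 : (0 : ℝ) < n := by exact_mod_cast hn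
  have hz0 : ∀ k, z 0 k = 0 := fun k => by
    have : ∫ y in (0 : ℝ)..1, Z 0 y * ρ (y - k / n) = ∫ _ in (0 : ℝ)..1, (0 : ℝ) :=
      intervalIntegral.integral_congr fun y hy => by
        rw [uIcc_of_le zero_le_one] at hy
        simp [hZ.initial y hy]
    simpa [hz, mollify] using this
  -- A node with a large difference lies where the translates of `ρ` are admissible test functions.
  have hinner : ∀ k ≤ n, ∀ u ∈ Icc 0 T, 4 * ε < |N u k - z u k| →
      (k : ℝ) / n ∈ Ioo r (1 - r) ∧ 0 < k ∧ k < n := by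
    intro k hk u hu hlt
    have hx := node_mem_Icc hn hk
    have hb1 : (k : ℝ) / n ∈ Ioo r (1 - r) := by
      by_contra hnot
      have h1 := hbdY u hu k hk hnot
      have h2 := abs_le.1 (hbdZ u hu _ hx hnot)
      have h3 := abs_le.1 (happrox u hu _ hx)
      have h4 := hY.nodeValue_nonneg hu.1 hk
      refine absurd hlt (not_lt.2 (abs_le.2 ?_))
      constructor <;> simp only [hN, hz] <;> linarith [h2.1, h2.2, h3.1, h3.2]
    refine ⟨hb1, Nat.pos_of_ne_zero fun h0 => ?_, lt_of_le_of_ne hk fun h0 => ?_⟩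
    · subst h0
      have h1 := hZ.boundary_left u hu.1
      have h3 := happrox u hu 0 (by simp)
      rw [h1] at h3
      simp only [hN, hz, nodeValue_zero, Nat.cast_zero, zero_div, zero_sub, abs_neg] at hlt
      rw [sub_zero] at h3
      linarith
    · subst h0
      have h1 := hZ.boundary_right u hu.1
      have h3 := happrox u hu 1 (by simp)
      rw [h1, sub_zero] at h3
      simp only [hN, hz, nodeValue_of_le _ le_rfl, div_self hn0.ne', zero_sub, abs_neg] at hlt
      linarith
  have hiiN : ∀ k s u, 0 ≤ s → s ≤ u → IntervalIntegrable
      (fun r => (n : ℝ) ^ 2 * (N r (k + 1) + N r (k - 1) - 2 * N r k)) volume s u :=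
    fun k s u hs hsu => ContinuousOn.intervalIntegrable <|
      ((((hNc _).add (hNc _)).sub ((hNc k).const_mul 2)).const_mul _).mono
        (by rw [uIcc_of_le hsu]; exact fun q hq => hs.trans hq.1)
  have hiiz : ∀ k s u, 0 ≤ s → s ≤ u → IntervalIntegrable
      (fun r => (n : ℝ) ^ 2 * (z r (k + 1) + z r (k - 1) - 2 * z r k)) volume s u :=
    fun k s u hs hsu => ContinuousOn.intervalIntegrable <|
      ((((hzc _).add (hzc _)).sub ((hzc k).const_mul 2)).const_mul _).mono
        (by rw [uIcc_of_le hsu]; exact fun q hq => hs.trans hq.1)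
  -- The drift of the mollified solution is its discrete Laplacian up to `b`.
  have hdrift : ∀ k : ℕ, 0 < k → ∀ s u, 0 ≤ s → s ≤ u → u ≤ T →
      |(∫ r in s..u, ∫ y in (0 : ℝ)..1, Z r y * iteratedDeriv 2 ρ (y - k / n))
        - ∫ r in s..u, (n : ℝ) ^ 2 * (z r (k + 1) + z r (k - 1) - 2 * z r k)| ≤ b * (u - s) := by
    intro k hk0 s u hs hsu huT
    have hii : IntervalIntegrable
        (fun r => ∫ y in (0 : ℝ)..1, Z r y * iteratedDeriv 2 ρ (y - k / n)) volume s u :=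
      ContinuousOn.intervalIntegrable <|
        (continuousOn_integral_mul hZ.continuous_Z
          (g := fun y => iteratedDeriv 2 ρ (y - k / n)) (by fun_prop)).mono
          (by rw [uIcc_of_le hsu]; exact fun q hq => hs.trans hq.1)
    rw [← intervalIntegral.integral_sub hii (hiiz k s u hs hsu), ← Real.norm_eq_abs]
    refine (intervalIntegral.norm_integral_le_of_norm_le_const (C := b) fun q hq => ?_).trans
      (by rw [abs_of_nonneg (sub_nonneg.2 hsu)])
    rw [uIoc_of_le hsu] at hq
    have := herr q ⟨hs.trans hq.1.le, hq.2.trans huT⟩ (k / n)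
    rw [Real.norm_eq_abs, abs_sub_comm]
    have e1 : (k : ℝ) / n + 1 / n = ((k + 1 : ℕ) : ℝ) / n := by push_cast; ring
    have e2 : (k : ℝ) / n - 1 / n = ((k - 1 : ℕ) : ℝ) / n := by
      rw [Nat.cast_sub (Nat.one_le_iff_ne_zero.2 hk0.ne')]; push_cast; ring
    rwa [e1, e2] at this
  have htrans : ∀ x, iteratedDeriv 2 (fun y => ρ (y - x)) = fun y => iteratedDeriv 2 ρ (y - x) :=
    fun x => iteratedDeriv_comp_sub_const 2 ρ x
  have hcd : ∀ x, ContDiff ℝ 2 fun y => ρ (y - x) := fun x => by fun_prop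
  have hcs : ∀ x, HasCompactSupport fun y => ρ (y - x) := fun x => by
    simpa [sub_eq_add_neg, Function.comp_def] using hρc.comp_homeomorph (Homeomorph.addRight (-x))
  have hup : N t k - z t k - 4 * ε ≤ b * t := by
    refine discrete_maximum_principle (n := n) (D := fun t k => N t k - z t k - 4 * ε) (T := T)
      hb (by positivity : (0 : ℝ) ≤ (n : ℝ) ^ 2)
      (fun k => ((hNc k).sub (hzc k)).sub continuousOn_const)
      (fun k _ => by simp [hN, hY.nodeValue_initial, hz0, hε.le]) ?_ k hk t ht
    intro j hj u hu hpos
    beta_reduce at hpos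
    have huT : u ∈ Icc 0 T := ⟨hu.1.le, hu.2⟩
    obtain ⟨hx, hj0, hjn⟩ := hinner j hj u huT
      ((by linarith : 4 * ε < N u j - z u j).trans_le (le_abs_self _))
    have hxI := node_mem_Icc hn hj
    have h1 := abs_le.1 (happrox u huT _ hxI)
    have h2 := hZ.obstacle_le u huT.1 _ hxI
    obtain ⟨s₁, hs₁, hinc⟩ := hY.exists_increment_eq hV huT.1 hj0 hjn (by
      simp only [hN, hz] at hpos
      linarith [h1.1])
    refine ⟨hj0, hjn, s₁, hs₁, fun s hs hs0 => ?_⟩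
    have h3 := hinc s hs hs0
    have h4 := hZ.le_increment hs0 hs.2.le (hcd (j / n)) (hcs _)
      (tsupport_comp_sub_subset hρs hx) (fun y => hρ0 _)
    simp only [htrans] at h4
    have h5 := abs_le.1 (hdrift j hj0 s u hs0 hs.2.le hu.2)
    have h6 := intervalIntegral.integral_sub (hiiN j s u hs0 hs.2.le) (hiiz j s u hs0 hs.2.le)
    have h7 : (∫ r in s..u, (n : ℝ) ^ 2 * (N r (j + 1) - z r (j + 1) - 4 * ε
          + (N r (j - 1) - z r (j - 1) - 4 * ε) - 2 * (N r j - z r j - 4 * ε)))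
        = ∫ r in s..u, ((n : ℝ) ^ 2 * (N r (j + 1) + N r (j - 1) - 2 * N r j)
          - (n : ℝ) ^ 2 * (z r (j + 1) + z r (j - 1) - 2 * z r j)) := by
      congr 1
      ext q
      ring
    rw [h7, h6]
    change N u j - N s j = ∫ r in s..u, (n : ℝ) ^ 2 * (N r (j + 1) + N r (j - 1) - 2 * N r j) at h3
    change _ ≤ z u j - z s j at h4
    linarith [h5.1, h5.2]
  have hdown : z t k - N t k - 4 * ε ≤ b * t := by
    refine discrete_maximum_principle (n := n) (D := fun t k => z t k - N t k - 4 * ε) (T := T)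
      hb (by positivity : (0 : ℝ) ≤ (n : ℝ) ^ 2)
      (fun k => ((hzc k).sub (hNc k)).sub continuousOn_const)
      (fun k _ => by simp [hN, hY.nodeValue_initial, hz0, hε.le]) ?_ k hk t ht
    intro j hj u hu hpos
    beta_reduce at hpos
    have huT : u ∈ Icc 0 T := ⟨hu.1.le, hu.2⟩
    obtain ⟨hx, hj0, hjn⟩ := hinner j hj u huT (by
      rw [abs_sub_comm]
      exact (by linarith : 4 * ε < z u j - N u j).trans_le (le_abs_self _))
    have hxI := node_mem_Icc hn hj
    have h1 := abs_le.1 (happrox u huT _ hxI)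
    have h2 := hY.obstacle_le_nodeValue huT.1 hj0 hjn
    refine ⟨hj0, hjn, u - d / 2, by linarith, fun s hs hs0 => ?_⟩
    have h3 := hY.le_increment hs0 hs.2.le hj0 hjn
    have h4 := hZ.increment_eq hV hs0 hs.2.le (hcd (j / n)) (hcs _)
      (tsupport_comp_sub_subset hρs hx) (fun q hq y hy hne => by
        have hqT : q ∈ Icc 0 T := ⟨hs0.trans hq.1, hq.2.trans hu.2⟩
        have hyI := Ioo_subset_Icc_self hy
        have hqu : |q - u| < d := by
          rw [abs_lt]
          constructor <;> linarith [hq.1, hq.2, hs.1]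
        have hyx : |y - j / n| < d := by
          have := hρs (subset_tsupport ρ hne)
          rw [Metric.mem_closedBall, Real.dist_eq, sub_zero] at this
          exact this.trans_lt hrd
        have m1 := (abs_lt.1 (hmodZ q hqT u huT y hyI _ hxI hqu hyx)).1
        have m2 := (abs_lt.1 (hmodV q hqT u huT y hyI _ hxI hqu hyx)).1
        simp only [hN, hz] at hpos
        linarith [h1.2])
    simp only [htrans] at h4
    have h5 := abs_le.1 (hdrift j hj0 s u hs0 hs.2.le hu.2)
    have h6 := intervalIntegral.integral_sub (hiiz j s u hs0 hs.2.le) (hiiN j s u hs0 hs.2.le)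
    have h7 : (∫ r in s..u, (n : ℝ) ^ 2 * (z r (j + 1) - N r (j + 1) - 4 * ε
          + (z r (j - 1) - N r (j - 1) - 4 * ε) - 2 * (z r j - N r j - 4 * ε)))
        = ∫ r in s..u, ((n : ℝ) ^ 2 * (z r (j + 1) + z r (j - 1) - 2 * z r j)
          - (n : ℝ) ^ 2 * (N r (j + 1) + N r (j - 1) - 2 * N r j)) := by
      congr 1
      ext q
      ring
    rw [h7, h6]
    change (∫ r in s..u, (n : ℝ) ^ 2 * (N r (j + 1) + N r (j - 1) - 2 * N r j))
      ≤ N u j - N s j at h3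
    change z u j - z s j = _ at h4
    linarith [h5.1, h5.2]
  rw [abs_le]
  constructor <;> linarith

/-! ### Uniform convergence -/

/-- Uniform convergence at the nodes: the difference is at most `5 ε` to the mollified solution, and
the mollification costs another `ε`. -/
theorem eventually_abs_nodeValue_sub_le {V Z : ℝ → ℝ → ℝ} {η : Measure (ℝ × ℝ)}
    (hV : ContinuousOn (fun p : ℝ × ℝ => V p.1 p.2) (Ici 0 ×ˢ Icc 0 1))
    (hZ : IsObstacleSolution V Z η) {Zn ηn : (n : ℕ) → ℝ → Fin (n - 1) → ℝ}
    (hZn : ∀ n : ℕ, 1 ≤ n → IsSkorohodSolution n (sample V n) (Zn n) (ηn n))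
    {T : ℝ} (hT : 0 < T) {ε : ℝ} (hε : 0 < ε) :
    ∀ᶠ n : ℕ in atTop, ∀ t ∈ Icc 0 T, ∀ k ≤ n,
      |nodeValue n (Zn n t) k - Z t (k / n)| ≤ 6 * ε := by
  have h0 : (0 : ℝ) ∈ Icc (0 : ℝ) 1 := by simp
  have h1 : (1 : ℝ) ∈ Icc (0 : ℝ) 1 := by simp
  obtain ⟨d₁, hd₁, hmodZ⟩ := exists_modulus hZ.continuous_Z T hε
  obtain ⟨d₂, hd₂, hmodV⟩ := exists_modulus hV T hε
  obtain ⟨M, hM, hbdZ⟩ := exists_bound hZ.continuous_Z T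
  obtain ⟨δ, hδ, hbdY⟩ := exists_nodeValue_le_near_boundary hV (T := T)
    (fun t ht => by
      have := hZ.obstacle_le t ht.1 0 h0
      rw [hZ.boundary_left t ht.1] at this
      linarith)
    (fun t ht => by
      have := hZ.obstacle_le t ht.1 1 h1
      rw [hZ.boundary_right t ht.1] at this
      linarith) hε
  set d := min d₁ d₂ with hd
  have hdpos : 0 < d := lt_min hd₁ hd₂
  set r := min δ (d / 2) with hr
  have hrpos : 0 < r := lt_min hδ (by positivity)
  have hrd : r < d := (min_le_right _ _).trans_lt (by linarith)
  have hrδ : r ≤ δ := min_le_left _ _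
  let f : ContDiffBump (0 : ℝ) := ⟨r / 2, r, by positivity, by linarith⟩
  set ρ : ℝ → ℝ := f.normed volume with hρdef
  have hρ : ContDiff ℝ 2 ρ := f.contDiff_normed (n := 2)
  have hρc : HasCompactSupport ρ := f.hasCompactSupport_normed
  have hρs : tsupport ρ ⊆ Metric.closedBall 0 r := by rw [hρdef, f.tsupport_normed_eq]
  have hρr : ∀ w, r ≤ |w| → ρ w = 0 := fun w hw => by
    by_contra hne
    have : w ∈ Function.support ρ := hne
    rw [hρdef, f.support_normed_eq, Metric.mem_ball, Real.dist_eq, sub_zero] at this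
    exact absurd this (not_lt.2 hw)
  -- With this bound on the second difference of `ρ` the drift error is `ε / T`, so `ε` up to `T`.
  have hb : 0 < ε / T / M := by positivity
  obtain ⟨h₀, hh₀, hsec⟩ := exists_second_difference_le hρ hρc hb
  filter_upwards [eventually_ge_atTop 1,
    (tendsto_one_div_atTop_nhds_zero_nat (𝕜 := ℝ)).eventually_lt_const hh₀] with n hn hnh t ht k hk
  have hn0 : (0 : ℝ) < n := by exact_mod_cast hn
  have happrox : ∀ t ∈ Icc 0 T, ∀ x ∈ Icc (0 : ℝ) 1, |mollify ρ (Z t) x - Z t x| ≤ ε :=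
    fun t ht x hx => abs_mollify_sub_le (continuousOn_slice hZ.continuous_Z ht.1)
      (hZ.boundary_left t ht.1) (hZ.boundary_right t ht.1) hρ.continuous hρc
      (fun w => f.nonneg_normed w) f.integral_normed hρr
      (fun x hx y hy hxy => (hmodZ t ht t ht x hx y hy (by simpa using hd₁)
        (hxy.trans (hrd.trans_le (min_le_left _ _)))).le) hx
  have hmain := abs_nodeValue_sub_mollify_le hV hZ hn (hZn n hn) (T := T) (b := ε / T) hε hdpos
    (by positivity) hrd hρ hρc (fun w => f.nonneg_normed w) hρs
    (fun s hs t ht x hx y hy hst hxy => hmodZ s hs t ht x hx y hy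
      (hst.trans_le (min_le_left _ _)) (hxy.trans_le (min_le_left _ _)))
    (fun s hs t ht x hx y hy hst hxy => hmodV s hs t ht x hx y hy
      (hst.trans_le (min_le_right _ _)) (hxy.trans_le (min_le_right _ _)))
    happrox
    (fun t ht x => by
      have := abs_mollify_second_difference_le (continuousOn_slice hZ.continuous_Z ht.1) hρ
        (hbdZ t ht) (hsec (1 / n) (by positivity) hnh) x
      set A := mollify ρ (Z t) (x + 1 / n) + mollify ρ (Z t) (x - 1 / n)
        - 2 * mollify ρ (Z t) x
      set B := ∫ y in (0 : ℝ)..1, Z t y * iteratedDeriv 2 ρ (y - x)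
      have e1 : (n : ℝ) ^ 2 * A - B = (n : ℝ) ^ 2 * (A - (1 / n) ^ 2 * B) := by field_simp
      rw [e1, abs_mul, abs_of_nonneg (by positivity : (0 : ℝ) ≤ (n : ℝ) ^ 2)]
      calc (n : ℝ) ^ 2 * |A - (1 / n) ^ 2 * B|
          ≤ (n : ℝ) ^ 2 * ((1 / n) ^ 2 * (M * (ε / T / M))) :=
            mul_le_mul_of_nonneg_left this (by positivity)
        _ = ε / T := by field_simp)
    (fun t ht k hk hnot => hbdY n _ _ hn (hZn n hn) t ht k hk
      fun h => hnot ⟨hrδ.trans_lt h.1, h.2.trans_le (by linarith)⟩)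
    (fun t ht x hx hnot => by
      have hd1 : r < d₁ := hrd.trans_le (min_le_left _ _)
      rw [mem_Ioo, not_and_or, not_lt, not_lt] at hnot
      rcases hnot with hl | hr
      · have := hmodZ t ht t ht x hx 0 h0 (by simpa using hd₁)
          (by rw [sub_zero, abs_of_nonneg hx.1]; exact hl.trans_lt hd1)
        rw [hZ.boundary_left t ht.1, sub_zero] at this
        exact this.le
      · have := hmodZ t ht t ht x hx 1 h1 (by simpa using hd₁)
          (by rw [abs_sub_comm, abs_of_nonneg (sub_nonneg.2 hx.2)]; linarith)
        rw [hZ.boundary_right t ht.1, sub_zero] at this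
        exact this.le) ht hk
  have h2 := happrox t ht _ (node_mem_Icc hn hk)
  have h3 : ε / T * t ≤ ε := by
    calc ε / T * t ≤ ε / T * T := mul_le_mul_of_nonneg_left ht.2 (by positivity)
      _ = ε := by field_simp
  calc |nodeValue n (Zn n t) k - Z t (k / n)|
      ≤ |nodeValue n (Zn n t) k - mollify ρ (Z t) (k / n)|
        + |mollify ρ (Z t) (k / n) - Z t (k / n)| := abs_sub_le _ _ _
    _ ≤ 6 * ε := by linarith

/-- The interpolated value at `x` is a convex combination of the values at the two neighbouring
nodes. -/
theorem abs_interpolate_sub_le {n : ℕ} (hn : 1 ≤ n) (z : Fin (n - 1) → ℝ) {x a C : ℝ}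
    (hx : x ∈ Icc (0 : ℝ) 1)
    (h : ∀ k ≤ n, |(k : ℝ) / n - x| ≤ 1 / n → |nodeValue n z k - a| ≤ C) :
    |interpolate n z x - a| ≤ C := by
  have hn0 : (0 : ℝ) < n := by exact_mod_cast hn
  have hnx : 0 ≤ (n : ℝ) * x := mul_nonneg hn0.le hx.1
  set k := ⌊(n : ℝ) * x⌋₊ with hk
  have hk1 : (k : ℝ) ≤ n * x := Nat.floor_le hnx
  have hk2 : (n : ℝ) * x < k + 1 := Nat.lt_floor_add_one _
  have hkn : k ≤ n := by
    have : (k : ℝ) ≤ n := hk1.trans (mul_le_of_le_one_right hn0.le hx.2)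
    exact_mod_cast this
  have hnode : ∀ j : ℕ, |(j : ℝ) - n * x| ≤ 1 → |(j : ℝ) / n - x| ≤ 1 / n := fun j hj => by
    have : (j : ℝ) / n - x = (j - n * x) / n := by field_simp
    rw [this, abs_div, abs_of_pos hn0]
    gcongr
  have h1 := h k hkn (hnode k (by rw [abs_le]; constructor <;> linarith))
  set θ := (n : ℝ) * x - k with hθ
  have h2 : |nodeValue n z (k + 1) - a| ≤ C := by
    rcases hkn.eq_or_lt with he | hlt
    · -- At `x = 1` the node to the right does not exist; both node values vanish.
      rwa [nodeValue_of_le z (by omega), ← nodeValue_of_le z he.ge]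
    · refine h (k + 1) hlt (hnode _ ?_)
      push_cast
      rw [abs_le]
      constructor <;> linarith
  have hθ0 : 0 ≤ θ := by linarith
  have hθ1 : 0 ≤ 1 - θ := by linarith
  have e : interpolate n z x - a
      = (1 - θ) * (nodeValue n z k - a) + θ * (nodeValue n z (k + 1) - a) := by
    simp only [interpolate, ← hk, ← hθ]
    ring
  rw [e]
  calc _ ≤ |(1 - θ) * (nodeValue n z k - a)| + |θ * (nodeValue n z (k + 1) - a)| := abs_add_le _ _
    _ = (1 - θ) * |nodeValue n z k - a| + θ * |nodeValue n z (k + 1) - a| := by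
      rw [abs_mul, abs_mul, abs_of_nonneg hθ0, abs_of_nonneg hθ1]
    _ ≤ (1 - θ) * C + θ * C := by gcongr
    _ = C := by ring

end ParabolicObstacle

theorem theorem4p1 (V : ℝ → ℝ → ℝ)
    (hV : ContinuousOn (fun p : ℝ × ℝ => V p.1 p.2) (Ici 0 ×ˢ Icc 0 1))
    (hV0 : ∀ x ∈ Icc (0 : ℝ) 1, 0 ≤ V 0 x)
    (Z : ℝ → ℝ → ℝ) (η : Measure (ℝ × ℝ))
    (hZ : ParabolicObstacle.IsObstacleSolution V Z η)
    (Zn ηn : (n : ℕ) → ℝ → Fin (n - 1) → ℝ)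
    (hZn : ∀ n : ℕ, 1 ≤ n →
      ParabolicObstacle.IsSkorohodSolution n (ParabolicObstacle.sample V n) (Zn n) (ηn n))
    (T : ℝ) (hT : 0 < T) :
    TendstoUniformlyOn
      (fun (n : ℕ) (p : ℝ × ℝ) => ParabolicObstacle.interpolate n (Zn n p.1) p.2)
      (fun p : ℝ × ℝ => Z p.1 p.2) atTop (Icc 0 T ×ˢ Icc 0 1) := by
  rw [Metric.tendstoUniformlyOn_iff]
  intro ε hε
  have hε' : 0 < ε / 8 := by positivity
  obtain ⟨d, hd, hmod⟩ := ParabolicObstacle.exists_modulus hZ.continuous_Z T hε'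
  filter_upwards [eventually_ge_atTop 1,
    ParabolicObstacle.eventually_abs_nodeValue_sub_le hV hZ hZn hT hε',
    (tendsto_one_div_atTop_nhds_zero_nat (𝕜 := ℝ)).eventually_lt_const hd]
    with n hn hnode hnd p hp
  rw [dist_comm, Real.dist_eq]
  refine lt_of_le_of_lt (ParabolicObstacle.abs_interpolate_sub_le hn _ (C := 7 * (ε / 8)) hp.2
    fun k hk hkx => ?_) (by linarith)
  have h1 := hnode p.1 hp.1 k hk
  have h2 := hmod p.1 hp.1 p.1 hp.1 _ (ParabolicObstacle.node_mem_Icc hn hk) _ hp.2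
    (by simpa using hd) (hkx.trans_lt hnd)
  exact (abs_sub_le _ (Z p.1 (k / n)) _).trans (by linarith)
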